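/- For an infinite cardinal $\kappa$, let $\mathsf{MA}(\kappa)$ denote Martin's axiom for $ccc$ partial orders and $\kappa$ many dense sets: for every nonempty $ccc$ partial order $P$ and every family $\mathcal D$ of at most $\kappa$ dense subsets of $P$ there is a filter in $P$ that meets every member of $\mathcal D$. The height of a scattered space $K$ is the first ordinal $\alpha$ for which the Cantor--Bendixson derivative $K^{(\alpha)}$ is empty, and the weight of $K$ is the least cardinality of a base of its topology. Assume $\mathsf{MA}(\kappa)$, and let $K$ be a separable scattered compact Hausdorff space of height $3$ and weight $\kappa$. Let $C(K)$ be the Banach space of continuous real-valued functions on $K$ with the supremum norm, and let $c_0(C(K))$ be its $c_0$-direct sum, that is, the Banach space of all sequences in $C(K)$ that converge to $0$ in norm, with the supremum norm. Then $c_0(C(K))$ is isomorphic to $C(K)$, as a Banach space (by a linear homeomorphism). In particular, $C(K)$ is isomorphic to its square $C(K)\oplus C(K)$. -/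

import Mathlib

open Set Topology Cardinal ZeroAtInfty

universe u

/-- Two conditions of a partial order are compatible if they have a common lower bound. -/
def Compatible {P : Type u} [PartialOrder P] (p q : P) : Prop :=
  ∃ r : P, r ≤ p ∧ r ≤ q

/-- A partial order satisfies the countable chain condition (is `ccc`) if every set of pairwise
incompatible elements is countable. -/
def IsCCC (P : Type u) [PartialOrder P] : Prop :=
  ∀ A : Set P, A.Pairwise (fun p q => ¬ Compatible p q) → A.Countable

/-- Martin's axiom `MA(κ)`: for every nonempty `ccc` partial order `P` and every family `𝒟` of at
most `κ` dense subsets of `P` there is a filter in `P` that meets every member of `𝒟`.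
(A set `D` is dense if every element of `P` has a lower bound in `D`, that is, if it is coinitial.
`Order.PFilter P` consists of the nonempty, downward directed upper sets.) -/
def MartinsAxiom (κ : Cardinal.{u}) : Prop :=
  ∀ (P : Type u) [PartialOrder P] [Nonempty P], IsCCC P →
    ∀ 𝒟 : Set (Set P), #𝒟 ≤ κ → (∀ D ∈ 𝒟, IsCoinitial D) →
      ∃ G : Order.PFilter P, ∀ D ∈ 𝒟, ∃ p ∈ G, p ∈ D

/-- A topological space is scattered if each of its nonempty subsets has an isolated point. -/
def IsScattered (X : Type u) [TopologicalSpace X] : Prop :=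
  ∀ S : Set X, S.Nonempty → ∃ x ∈ S, ∃ U : Set X, IsOpen U ∧ U ∩ S = {x}

/-- The height of a space: the first ordinal `α` for which the Cantor-Bendixson derivative
`X^(α)` is empty. It is used only for scattered spaces, where such an ordinal exists. -/
noncomputable def scatteredHeight (X : Type u) [TopologicalSpace X] : Ordinal.{u} :=
  sInf {α : Ordinal.{u} | CantorBendixson.iteratedDerivedSet (Set.univ : Set X) α = ∅}

/-- The weight of a space: the least cardinality of a base of its topology. -/
noncomputable def topologicalWeight (X : Type u) [TopologicalSpace X] : Cardinal.{u} :=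
  sInf {c : Cardinal.{u} | ∃ B : Set (Set X), TopologicalSpace.IsTopologicalBasis B ∧ #B = c}

/-- The `c₀`-direct sum `c₀(E)` of countably many copies of a normed space `E`: the sequences in
`E` that converge to `0`, with the supremum norm. (Mathlib's space of functions `ℕ → E` vanishing
at infinity, for the discrete topology on `ℕ`.) -/
abbrev C0Sum (E : Type u) [NormedAddCommGroup E] : Type u := C₀(ℕ, E)

/-! The second derived set of `K` is nonempty and finite, since the third is empty. Its complement
`L` is a `Ψ`-space: countably many isolated points and an infinite set `I` of further points, each
of which has a compact open neighbourhood with no other nonisolated point. The traces of these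
neighbourhoods on the isolated points form an almost disjoint family. Up to a finite-dimensional
summand `C(K)` is `C₀(L)`, and `C₀(L)` absorbs such summands because it contains a complemented copy
of `c₀` (`MrowkaData.nonempty_absorb`, `nonempty_absorb_finiteDimensional`). Now `c₀(C₀(L))` is
`C₀(ℕ × L)`, and `ℕ × L` is again a `Ψ`-space with countably many isolated points and `|I|` others.
So it suffices that `C₀` of a `Ψ`-space depends, under Martin's axiom, only on the number of
nonisolated points.

For this, regard `C₀(L)` as an extension of a space of functions on `I` by `c₀`, the kernel of
restriction to the nonisolated points. By `MartinsAxiom.exists_transfer` there are sets `S n` of at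
most two integers such that, for each `i`, the set `S n` has for almost all `n` exactly one point in
`A i` when `n ∈ B i` and none otherwise. Summation over `S n` is then an operator from one function
space to the other that keeps the values on `I` (`MrowkaData.exists_coe_eq_transferFun`). With
operators in both directions over the same quotient, a Schanuel argument (`diagonalEquiv`) makes the
two spaces isomorphic after adding `c₀` to each, and both absorb `c₀`. -/

/-! ### Almost disjoint families and the forcing that transforms one into another -/

section AlmostDisjoint

open Classical in
/-- `S` meets `A` in exactly one point if `n ∈ B` and is disjoint from `A` otherwise. -/
def MeetsAccording (A B : Set ℕ) (n : ℕ) (S : Finset ℕ) : Prop :=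
  {m ∈ S | m ∈ A}.card = if n ∈ B then 1 else 0

variable {I : Type u} {A B : I → Set ℕ}

-- Almost disjointness leaves in each `A i` a point beyond `n` that lies in no other `A j` with `j ∈
-- F`. One such private point is taken for each `i ∈ F` with `n ∈ B i`.
open Classical in
theorem exists_finset_meetsAccording (hA : ∀ i, (A i).Infinite)
    (hAd : ∀ i j, i ≠ j → (A i ∩ A j).Finite) (F : Finset I) (n : ℕ)
    (hF : {i ∈ F | n ∈ B i}.card ≤ 2) :
    ∃ S : Finset ℕ, S.card ≤ 2 ∧ (∀ m ∈ S, n ≤ m) ∧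
      ∀ i ∈ F, MeetsAccording (A i) (B i) n S := by
  have h : ∀ i, ∃ m ∈ A i, n ≤ m ∧ ∀ j ∈ F, j ≠ i → m ∉ A j := by
    intro i
    have hfin : (Set.Iio n ∪ ⋃ j ∈ (F.erase i : Finset I), A i ∩ A j).Finite := by
      refine (Set.finite_Iio n).union (Set.Finite.biUnion (Finset.finite_toSet _) ?_)
      intro j hj
      exact hAd i j (Finset.ne_of_mem_erase hj).symm
    obtain ⟨m, hm, hm'⟩ := ((hA i).sdiff hfin).nonempty
    refine ⟨m, hm, ?_, fun j hj hji hmj => hm' (Or.inr ?_)⟩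
    · by_contra hlt
      exact hm' (Or.inl (not_le.mp hlt))
    · exact Set.mem_biUnion (Finset.mem_erase.mpr ⟨hji, hj⟩) ⟨hm, hmj⟩
  choose g hgA hgn hgF using h
  refine ⟨{i ∈ F | n ∈ B i}.image g, Finset.card_image_le.trans hF, ?_, ?_⟩
  · simp only [Finset.mem_image]
    rintro m ⟨i, -, rfl⟩
    exact hgn i
  · intro i hi
    unfold MeetsAccording
    by_cases hn : n ∈ B i
    · rw [if_pos hn, Finset.card_eq_one]
      refine ⟨g i, ?_⟩
      ext m
      simp only [Finset.mem_filter, Finset.mem_image, Finset.mem_singleton]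
      constructor
      · rintro ⟨⟨j, ⟨hj, hjn⟩, rfl⟩, hm⟩
        by_contra hne
        exact hgF j i hi (fun h => hne (h ▸ rfl)) hm
      · rintro rfl
        exact ⟨⟨i, ⟨hi, hn⟩, rfl⟩, hgA i⟩
    · rw [if_neg hn, Finset.card_eq_zero, Finset.filter_eq_empty_iff]
      simp only [Finset.mem_image, Finset.mem_filter]
      rintro m ⟨j, ⟨hj, hjn⟩, rfl⟩
      exact hgF j i hi (fun h => hn (h ▸ hjn))

/-- Finite approximations to a sequence of sets of at most two integers which transforms the
family `A` into the family `B`. -/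
@[ext]
structure TransferCondition (A B : I → Set ℕ) where
  len : ℕ
  seq : ℕ → Finset ℕ
  promise : Finset I
  seq_eq_empty : ∀ n, len ≤ n → seq n = ∅
  card_le : ∀ n, (seq n).card ≤ 2
  le_of_mem : ∀ n, ∀ m ∈ seq n, n ≤ m
  -- Beyond `len` the promised sets `B i` are disjoint, so each later `n` makes at most one demand
  -- per condition. This is what leaves room for two conditions within the bound of two points.
  separated : ∀ i ∈ promise, ∀ j ∈ promise, ∀ n, len ≤ n → n ∈ B i → n ∈ B j → i = j

namespace TransferCondition

/-- A stronger condition must honour the old promises only at the newly decided places. The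
normalisation `seq_eq_empty` gives antisymmetry. -/
instance : PartialOrder (TransferCondition A B) where
  le p q := q.len ≤ p.len ∧ (∀ n < q.len, p.seq n = q.seq n) ∧ q.promise ⊆ p.promise ∧
    ∀ n, q.len ≤ n → n < p.len → ∀ i ∈ q.promise, MeetsAccording (A i) (B i) n (p.seq n)
  le_refl p := ⟨le_rfl, fun _ _ => rfl, subset_rfl, fun _ h h' => absurd h' h.not_gt⟩
  le_trans p q r := by
    rintro ⟨h1, h2, h3, h4⟩ ⟨k1, k2, k3, k4⟩
    refine ⟨k1.trans h1, fun n hn => (h2 n (hn.trans_le k1)).trans (k2 n hn), k3.trans h3, ?_⟩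
    intro n hn hn' i hi
    rcases lt_or_ge n q.len with h | h
    · rw [h2 n h]
      exact k4 n hn h i hi
    · exact h4 n h hn' i (k3 hi)
  le_antisymm p q := by
    rintro ⟨h1, h2, h3, -⟩ ⟨k1, -, k3, -⟩
    have hl : p.len = q.len := le_antisymm k1 h1
    refine TransferCondition.ext hl ?_ (k3.antisymm h3)
    funext n
    rcases lt_or_ge n q.len with h | h
    · exact h2 n h
    · rw [q.seq_eq_empty n h, p.seq_eq_empty n (hl ▸ h)]

theorem le_def {p q : TransferCondition A B} : p ≤ q ↔
    q.len ≤ p.len ∧ (∀ n < q.len, p.seq n = q.seq n) ∧ q.promise ⊆ p.promise ∧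
    ∀ n, q.len ≤ n → n < p.len → ∀ i ∈ q.promise, MeetsAccording (A i) (B i) n (p.seq n) :=
  Iff.rfl

instance : Nonempty (TransferCondition A B) :=
  ⟨⟨0, fun _ => ∅, ∅, by simp, by simp, by simp, by simp⟩⟩

-- At each undecided `n` the two promises together demand at most `1 + 1` points, which the bound in
-- `card_le` permits. The case `p = q` lengthens a condition, and the general case drives both the
-- chain condition and the density of promises.
open Classical in
theorem exists_common_lower_bound (hA : ∀ i, (A i).Infinite)
    (hAd : ∀ i j, i ≠ j → (A i ∩ A j).Finite) (hBd : ∀ i j, i ≠ j → (B i ∩ B j).Finite)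
    (p q : TransferCondition A B) (hlen : p.len = q.len) (hseq : p.seq = q.seq) (N : ℕ) :
    ∃ r, r ≤ p ∧ r ≤ q ∧ N ≤ r.len := by
  set F := p.promise ∪ q.promise with hF
  have hcard : ∀ n, p.len ≤ n → {i ∈ F | n ∈ B i}.card ≤ 2 := by
    intro n hn
    rw [hF, Finset.filter_union]
    refine (Finset.card_union_le _ _).trans (add_le_add (b := 1) (d := 1) ?_ ?_)
    · rw [Finset.card_le_one]
      simp only [Finset.mem_filter]
      rintro i ⟨hi, hi'⟩ j ⟨hj, hj'⟩
      exact p.separated i hi j hj n hn hi' hj'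
    · rw [Finset.card_le_one]
      simp only [Finset.mem_filter]
      rintro i ⟨hi, hi'⟩ j ⟨hj, hj'⟩
      exact q.separated i hi j hj n (hlen ▸ hn) hi' hj'
  have hex : ∀ n, ∃ S : Finset ℕ, S.card ≤ 2 ∧ (∀ m ∈ S, n ≤ m) ∧
      (p.len ≤ n → ∀ i ∈ F, MeetsAccording (A i) (B i) n S) := by
    intro n
    by_cases hn : p.len ≤ n
    · obtain ⟨S, h1, h2, h3⟩ := exists_finset_meetsAccording hA hAd F n (hcard n hn)
      exact ⟨S, h1, h2, fun _ => h3⟩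
    · exact ⟨∅, by simp, by simp, fun h => absurd h hn⟩
  choose S hS2 hSn hSF using hex
  -- The joint promise is separated only beyond some `M`, so the sequence has to be decided at least
  -- up to there.
  obtain ⟨M, hM⟩ : ∃ M, ∀ i ∈ F, ∀ j ∈ F, ∀ n, M ≤ n → n ∈ B i → n ∈ B j → i = j := by
    have hfin : (⋃ x ∈ F.offDiag, B x.1 ∩ B x.2).Finite :=
      Set.Finite.biUnion (Finset.finite_toSet _) fun x hx =>
        hBd _ _ (Finset.mem_offDiag.mp hx).2.2
    obtain ⟨M, hM⟩ := hfin.bddAbove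
    refine ⟨M + 1, fun i hi j hj n hn hni hnj => ?_⟩
    by_contra hij
    have : n ≤ M := hM (Set.mem_biUnion (x := (i, j)) (Finset.mem_offDiag.mpr ⟨hi, hj, hij⟩)
      ⟨hni, hnj⟩)
    omega
  let l := max p.len (max M N)
  have hl : p.len ≤ l := le_max_left _ _
  let t : ℕ → Finset ℕ := fun n => if n < p.len then p.seq n else if n < l then S n else ∅
  have ht : ∀ n < p.len, t n = p.seq n := fun n hn => if_pos hn
  have ht' : ∀ n, p.len ≤ n → n < l → t n = S n := fun n hn hn' => by
    simp only [t, if_neg hn.not_gt, if_pos hn']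
  refine ⟨⟨l, t, F, ?_, ?_, ?_, ?_⟩, ?_, ?_, ?_⟩
  · intro n hn
    simp only [t, if_neg hn.not_gt, if_neg (hl.trans hn).not_gt]
  · intro n
    simp only [t]
    split_ifs
    exacts [p.card_le n, hS2 n, by simp]
  · intro n
    simp only [t]
    split_ifs
    exacts [p.le_of_mem n, hSn n, by simp]
  · intro i hi j hj n hn
    exact hM i hi j hj n (((le_max_left _ _).trans (le_max_right _ _)).trans hn)
  · refine ⟨hl, ht, Finset.subset_union_left, fun n hn hn' i hi => ?_⟩
    change MeetsAccording _ _ n (t n)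
    rw [ht' n hn hn']
    exact hSF n hn i (Finset.mem_union_left _ hi)
  · rw [le_def, ← hlen, ← hseq]
    refine ⟨hl, ht, Finset.subset_union_right, fun n hn hn' i hi => ?_⟩
    change MeetsAccording _ _ n (t n)
    rw [ht' n hn hn']
    exact hSF n hn i (Finset.mem_union_right _ hi)
  · exact (le_max_right _ _).trans (le_max_right _ _)

theorem isCCC (hA : ∀ i, (A i).Infinite)
    (hAd : ∀ i j, i ≠ j → (A i ∩ A j).Finite) (hBd : ∀ i j, i ≠ j → (B i ∩ B j).Finite) :
    IsCCC (TransferCondition A B) := by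
  intro 𝒜 h𝒜
  -- There are only countably many working parts, and conditions that share one are compatible.
  let φ : TransferCondition A B → Σ n : ℕ, (Fin n → Finset ℕ) :=
    fun p => ⟨p.len, fun i => p.seq i⟩
  have hφ : ∀ p q, φ p = φ q → p.len = q.len ∧ p.seq = q.seq := by
    intro p q hpq
    have hl : p.len = q.len := congrArg Sigma.fst hpq
    refine ⟨hl, funext fun n => ?_⟩
    rcases lt_or_ge n p.len with h | h
    · have key : ∀ x y : Σ n : ℕ, (Fin n → Finset ℕ), x = y → ∀ (h : n < x.1) (h' : n < y.1),
          x.2 ⟨n, h⟩ = y.2 ⟨n, h'⟩ := by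
        rintro x y rfl h h'
        rfl
      exact key _ _ hpq h (lt_of_lt_of_eq h hl)
    · rw [p.seq_eq_empty n h, q.seq_eq_empty n (hl ▸ h)]
  refine Set.MapsTo.countable_of_injOn (f := φ) (t := Set.univ) (Set.mapsTo_univ _ _) ?_
    (Set.to_countable _)
  intro p hp q hq hpq
  by_contra hne
  obtain ⟨r, hrp, hrq, -⟩ :=
    exists_common_lower_bound hA hAd hBd p q (hφ p q hpq).1 (hφ p q hpq).2 0
  exact h𝒜 hp hq hne ⟨r, hrp, hrq⟩

end TransferCondition

/-- Under Martin's axiom, any almost disjoint family of infinite sets can be transformed into any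
other almost disjoint family by a sequence of sums of at most two point masses. -/
theorem MartinsAxiom.exists_transfer {κ : Cardinal.{u}} (hMA : MartinsAxiom κ) (hκ : ℵ₀ ≤ κ)
    (hI : #I ≤ κ) (hA : ∀ i, (A i).Infinite) (hAd : ∀ i j, i ≠ j → (A i ∩ A j).Finite)
    (hBd : ∀ i j, i ≠ j → (B i ∩ B j).Finite) :
    ∃ S : ℕ → Finset ℕ, (∀ n, (S n).card ≤ 2) ∧ (∀ n, ∀ m ∈ S n, n ≤ m) ∧
      ∀ i, ∃ N, ∀ n, N ≤ n → MeetsAccording (A i) (B i) n (S n) := by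
  let P := TransferCondition A B
  let D : ULift.{u} ℕ ⊕ I → Set P :=
    Sum.elim (fun N => {p | N.down ≤ p.len}) (fun i => {p | i ∈ p.promise})
  have hcard : #(Set.range D) ≤ κ := by
    refine mk_range_le.trans ?_
    rw [mk_sum, Cardinal.lift_id, Cardinal.lift_id]
    refine Cardinal.add_le_of_le hκ ?_ hI
    simpa using hκ
  have hdense : ∀ E ∈ Set.range D, IsCoinitial E := by
    rintro _ ⟨x | i, rfl⟩ p
    · obtain ⟨r, hr, -, hN⟩ :=
        TransferCondition.exists_common_lower_bound hA hAd hBd p p rfl rfl x.down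
      exact ⟨r, hN, hr⟩
    -- A single promise is separated trivially; a common extension of `p` and this condition
    -- promises `i`.
    · let q : P := ⟨p.len, p.seq, {i}, p.seq_eq_empty, p.card_le, p.le_of_mem, by
        simp only [Finset.mem_singleton]
        rintro _ rfl _ rfl _ _ _ _
        rfl⟩
      obtain ⟨r, hr, hrq, -⟩ :=
        TransferCondition.exists_common_lower_bound hA hAd hBd p q rfl rfl 0
      exact ⟨r, hrq.2.2.1 (Finset.mem_singleton_self i), hr⟩
  obtain ⟨G, hG⟩ := hMA P (TransferCondition.isCCC hA hAd hBd) (Set.range D) hcard hdense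
  have hlen : ∀ n, ∃ p ∈ G, n < p.len := fun n => by
    obtain ⟨p, hp, hp'⟩ := hG _ ⟨Sum.inl ⟨n + 1⟩, rfl⟩
    exact ⟨p, hp, hp'⟩
  choose p hpG hp using hlen
  -- The generic sequence: its `n`-th term is read from a condition in the filter that has decided
  -- it. Directedness compares that condition with one promising `i`, whose length serves as the
  -- threshold.
  refine ⟨fun n => (p n).seq n, fun n => (p n).card_le n, fun n => (p n).le_of_mem n, fun i => ?_⟩
  obtain ⟨q, hq, hqi⟩ := hG _ ⟨Sum.inr i, rfl⟩
  refine ⟨q.len, fun n hn => ?_⟩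
  obtain ⟨r, -, hrp, hrq⟩ := G.directed _ (hpG n) _ hq
  have hrp' : r ≤ p n := hrp
  have hrq' : r ≤ q := hrq
  have h1 := hrp'.2.1 n (hp n)
  have h2 := hrq'.2.2.2 n hn ((hp n).trans_le hrp'.1) i hqi
  rwa [h1] at h2

end AlmostDisjoint

/-! ### Spaces of functions vanishing at infinity and isomorphisms between them -/

section ZeroAtInftySpaces

open Filter

variable {α β L E F : Type*} [TopologicalSpace α] [TopologicalSpace β] [TopologicalSpace L]
  [NormedAddCommGroup E] [NormedAddCommGroup F]

namespace ZeroAtInftyContinuousMap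

theorem norm_apply_le (f : C₀(α, E)) (x : α) : ‖f x‖ ≤ ‖f‖ :=
  f.toBCF.norm_coe_le_norm x

theorem norm_le_of_forall {f : C₀(α, E)} {C : ℝ} (hC : 0 ≤ C) (h : ∀ x, ‖f x‖ ≤ C) : ‖f‖ ≤ C :=
  (BoundedContinuousFunction.norm_le hC (f := f.toBCF)).mpr h

theorem tendsto_cocompact_zero_iff {f : α → E} : Tendsto f (cocompact α) (𝓝 0) ↔
    ∀ ε > 0, ∃ C : Set α, IsCompact C ∧ ∀ x, x ∉ C → ‖f x‖ < ε := by
  rw [(hasBasis_cocompact).tendsto_iff Metric.nhds_basis_ball]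
  simp

theorem exists_isCompact (f : C₀(α, E)) {ε : ℝ} (hε : 0 < ε) :
    ∃ C : Set α, IsCompact C ∧ ∀ x, x ∉ C → ‖f x‖ < ε :=
  tendsto_cocompact_zero_iff.mp f.zero_at_infty' ε hε

/-- A function which vanishes at infinity. -/
def ofBound (f : α → E) (hf : Continuous f)
    (h : ∀ ε > 0, ∃ C : Set α, IsCompact C ∧ ∀ x, x ∉ C → ‖f x‖ < ε) : C₀(α, E) :=
  ⟨⟨f, hf⟩, tendsto_cocompact_zero_iff.mpr h⟩

@[simp] theorem ofBound_apply (f : α → E) (hf h) (x : α) : ofBound f hf h x = f x := rfl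

theorem exists_coe_eq_of_approx {g : α → E}
    (h : ∀ ε > 0, ∃ f : C₀(α, E), ∀ x, ‖g x - f x‖ < ε) : ∃ f : C₀(α, E), ⇑f = g := by
  refine ⟨ofBound g ?_ ?_, rfl⟩
  · refine continuous_of_uniform_approx_of_continuous fun U hU => ?_
    obtain ⟨ε, hε, hU⟩ := Metric.mem_uniformity_dist.mp hU
    obtain ⟨f, hf⟩ := h ε hε
    exact ⟨f, f.continuous, fun x => hU (by rw [dist_eq_norm]; exact hf x)⟩
  · intro ε hε
    obtain ⟨f, hf⟩ := h (ε / 2) (half_pos hε)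
    obtain ⟨C, hC, hfC⟩ := f.exists_isCompact (half_pos hε)
    refine ⟨C, hC, fun x hx => ?_⟩
    calc ‖g x‖ = ‖(g x - f x) + f x‖ := by rw [sub_add_cancel]
      _ ≤ ‖g x - f x‖ + ‖f x‖ := norm_add_le _ _
      _ < ε := by linarith [hf x, hfC x hx]

/-- At a point outside the range, the image of a compact set off which `f` is small is closed, so
its complement is a neighbourhood on which the extension is small. -/
theorem continuous_extend_zero [T2Space L] {e : α → L} (he : IsOpenEmbedding e) (f : C₀(α, E)) :
    Continuous (Function.extend e f 0) := by
  rw [continuous_iff_continuousAt]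
  intro x
  by_cases hx : x ∈ Set.range e
  · obtain ⟨a, rfl⟩ := hx
    rw [he.continuousAt_iff.symm]
    have : Function.extend e f 0 ∘ e = f := funext fun a => he.injective.extend_apply _ _ _
    rw [this]
    exact f.continuous.continuousAt
  · rw [ContinuousAt, Function.extend_apply' _ _ _ (fun h => hx h), Pi.zero_apply,
      Metric.tendsto_nhds]
    intro ε hε
    obtain ⟨C, hC, h⟩ := f.exists_isCompact hε
    have hC' : IsClosed (e '' C) := (hC.image he.continuous).isClosed
    filter_upwards [hC'.isOpen_compl.mem_nhds fun h => hx (Set.image_subset_range _ _ h)]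
      with y hy
    rw [dist_zero_right]
    by_cases hy' : y ∈ Set.range e
    · obtain ⟨a, rfl⟩ := hy'
      rw [he.injective.extend_apply]
      exact h a fun ha => hy ⟨a, ha, rfl⟩
    · rw [Function.extend_apply' _ _ _ (fun h => hy' h)]
      simpa using hε

variable [NormedSpace ℝ E] [NormedSpace ℝ F]

/-- Functions on a space are functions on a homeomorphic space. -/
noncomputable def domCongr (e : α ≃ₜ β) : C₀(β, E) ≃L[ℝ] C₀(α, E) :=
  LinearEquiv.toContinuousLinearEquivOfBounds
    { toFun := fun f => f.comp ⟨⟨e, e.continuous⟩, e.isClosedEmbedding.tendsto_cocompact⟩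
      invFun := fun f => f.comp ⟨⟨e.symm, e.symm.continuous⟩,
        e.symm.isClosedEmbedding.tendsto_cocompact⟩
      map_add' := fun _ _ => rfl
      map_smul' := fun _ _ => rfl
      left_inv := fun f => ext fun x => congrArg f (e.apply_symm_apply x)
      right_inv := fun f => ext fun x => congrArg f (e.symm_apply_apply x) } 1 1
    (fun f => by
      rw [one_mul]
      exact norm_le_of_forall (norm_nonneg _) fun x => f.norm_apply_le (e x))
    (fun f => by
      rw [one_mul]
      exact norm_le_of_forall (norm_nonneg _) fun x => f.norm_apply_le (e.symm x))

/-- Composition with a continuous linear map. -/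
noncomputable def postcomp (T : E →L[ℝ] F) : C₀(α, E) →L[ℝ] C₀(α, F) :=
  LinearMap.mkContinuous
    { toFun := fun f => ⟨⟨fun x => T (f x), T.continuous.comp f.continuous⟩, by
        have h := (T.continuous.tendsto 0).comp f.zero_at_infty'
        rwa [map_zero] at h⟩
      map_add' := fun f g => ext fun x => map_add T (f x) (g x)
      map_smul' := fun c f => ext fun x => map_smul T c (f x) } ‖T‖
    (fun f => norm_le_of_forall (by positivity) fun x => T.le_opNorm_of_le (f.norm_apply_le x))

/-- Isomorphic spaces of values yield isomorphic spaces of functions. -/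
noncomputable def codCongr (T : E ≃L[ℝ] F) : C₀(α, E) ≃L[ℝ] C₀(α, F) :=
  ContinuousLinearEquiv.equivOfInverse (postcomp (T : E →L[ℝ] F)) (postcomp (T.symm : F →L[ℝ] E))
    (fun f => ext fun x => T.symm_apply_apply (f x))
    (fun f => ext fun x => T.apply_symm_apply (f x))

/-- Functions on a topological sum are pairs of functions. -/
noncomputable def sumEquiv : C₀(α ⊕ β, E) ≃L[ℝ] C₀(α, E) × C₀(β, E) :=
  LinearEquiv.toContinuousLinearEquivOfBounds
    { toFun := fun f =>
        (f.comp ⟨⟨Sum.inl, continuous_inl⟩, IsClosedEmbedding.inl.tendsto_cocompact⟩,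
         f.comp ⟨⟨Sum.inr, continuous_inr⟩, IsClosedEmbedding.inr.tendsto_cocompact⟩)
      invFun := fun p => ofBound (Sum.elim p.1 p.2) (p.1.continuous.sumElim p.2.continuous) (by
        intro ε hε
        obtain ⟨C, hC, h⟩ := p.1.exists_isCompact hε
        obtain ⟨C', hC', h'⟩ := p.2.exists_isCompact hε
        refine ⟨Sum.inl '' C ∪ Sum.inr '' C',
          (hC.image continuous_inl).union (hC'.image continuous_inr), ?_⟩
        rintro (x | x) hx
        · exact h x fun hxC => hx (Or.inl ⟨x, hxC, rfl⟩)
        · exact h' x fun hxC => hx (Or.inr ⟨x, hxC, rfl⟩))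
      map_add' := fun _ _ => rfl
      map_smul' := fun _ _ => rfl
      left_inv := fun f => by
        ext (x | x) <;> rfl
      right_inv := fun p => rfl } 1 1
    (fun f => by
      rw [one_mul]
      exact max_le (norm_le_of_forall (norm_nonneg _) fun x => f.norm_apply_le _)
        (norm_le_of_forall (norm_nonneg _) fun x => f.norm_apply_le _))
    (fun p => by
      rw [one_mul]
      refine norm_le_of_forall (norm_nonneg _) ?_
      rintro (x | x)
      · exact (p.1.norm_apply_le x).trans (norm_fst_le p)
      · exact (p.2.norm_apply_le x).trans (norm_snd_le p))

/-- Functions on a one-point space are points. -/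
noncomputable def punitEquiv : C₀(Unit, E) ≃L[ℝ] E :=
  LinearEquiv.toContinuousLinearEquivOfBounds
    { toFun := fun f => f ()
      invFun := fun v => ofBound (fun _ => v) continuous_const
        (fun _ _ => ⟨Set.univ, isCompact_univ, fun x hx => absurd (Set.mem_univ x) hx⟩)
      map_add' := fun _ _ => rfl
      map_smul' := fun _ _ => rfl
      left_inv := fun f => rfl
      right_inv := fun v => rfl } 1 1
    (fun f => by
      rw [one_mul]
      exact f.norm_apply_le ())
    (fun v => by
      rw [one_mul]
      exact norm_le_of_forall (norm_nonneg _) fun x => le_rfl)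

/-- Functions on a finite set are tuples. -/
noncomputable def finEquiv {n : ℕ} : C₀(Fin n, ℝ) ≃L[ℝ] (Fin n → ℝ) :=
  LinearEquiv.toContinuousLinearEquivOfBounds
    { toFun := fun f => f
      invFun := fun v => ofBound v continuous_of_discreteTopology
        (fun _ _ => ⟨Set.univ, isCompact_univ, fun x hx => absurd (Set.mem_univ x) hx⟩)
      map_add' := fun _ _ => rfl
      map_smul' := fun _ _ => rfl
      left_inv := fun f => rfl
      right_inv := fun v => rfl } 1 1
    (fun f => by
      rw [one_mul]
      exact (pi_norm_le_iff_of_nonneg (norm_nonneg _)).mpr f.norm_apply_le)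
    (fun v => by
      rw [one_mul]
      exact norm_le_of_forall (norm_nonneg _) fun x => norm_le_pi_norm v x)

/-- Functions of two variables, the first one discrete, as functions of the first variable. -/
noncomputable def curryEquiv : C₀(ℕ × L, E) ≃L[ℝ] C₀(ℕ, C₀(L, E)) :=
  LinearEquiv.toContinuousLinearEquivOfBounds
    { toFun := fun f => ofBound
        (fun n => ofBound (fun x => f (n, x)) (by fun_prop) (by
          intro ε hε
          obtain ⟨C, hC, h⟩ := f.exists_isCompact hε
          exact ⟨Prod.snd '' C, hC.image continuous_snd,
            fun x hx => h _ fun hxC => hx ⟨_, hxC, rfl⟩⟩))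
        continuous_of_discreteTopology (by
          intro ε hε
          obtain ⟨C, hC, h⟩ := f.exists_isCompact (half_pos hε)
          refine ⟨Prod.fst '' C, hC.image continuous_fst, fun n hn => ?_⟩
          refine (norm_le_of_forall (half_pos hε).le fun x => ?_).trans_lt (half_lt_self hε)
          exact (h (n, x) fun hxC => hn ⟨_, hxC, rfl⟩).le)
      invFun := fun g => ofBound (fun p => g p.1 p.2)
        (continuous_prod_of_discrete_left.mpr fun n => (g n).continuous) (by
          intro ε hε
          obtain ⟨C, hC, h⟩ := g.exists_isCompact hε
          have hg : ∀ n, ∃ C : Set L, IsCompact C ∧ ∀ x, x ∉ C → ‖g n x‖ < ε :=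
            fun n => (g n).exists_isCompact hε
          choose K hK hgK using hg
          refine ⟨⋃ n ∈ C, ({n} : Set ℕ) ×ˢ K n, hC.finite_of_discrete.isCompact_biUnion
            fun n _ => isCompact_singleton.prod (hK n), ?_⟩
          rintro ⟨n, x⟩ hx
          by_cases hn : n ∈ C
          · exact hgK n x fun hxK => hx (Set.mem_biUnion hn ⟨rfl, hxK⟩)
          · exact ((g n).norm_apply_le x).trans_lt (h n hn))
      map_add' := fun _ _ => rfl
      map_smul' := fun _ _ => rfl
      left_inv := fun f => rfl
      right_inv := fun g => rfl } 1 1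
    (fun f => by
      rw [one_mul]
      exact norm_le_of_forall (norm_nonneg _) fun n =>
        norm_le_of_forall (norm_nonneg _) fun x => f.norm_apply_le (n, x))
    (fun g => by
      rw [one_mul]
      exact norm_le_of_forall (norm_nonneg _) fun p =>
        ((g p.1).norm_apply_le p.2).trans (g.norm_apply_le p.1))

/-- Extension by zero along an open embedding. -/
noncomputable def extendZero [T2Space L] {e : α → L} (he : IsOpenEmbedding e) :
    C₀(α, E) →ₗᵢ[ℝ] C₀(L, E) where
  toFun f := ofBound (Function.extend e f 0) (continuous_extend_zero he f) (by
    intro ε hε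
    obtain ⟨C, hC, h⟩ := f.exists_isCompact hε
    refine ⟨e '' C, hC.image he.continuous, fun y hy => ?_⟩
    by_cases hy' : y ∈ Set.range e
    · obtain ⟨a, rfl⟩ := hy'
      rw [he.injective.extend_apply]
      exact h a fun ha => hy ⟨a, ha, rfl⟩
    · rw [Function.extend_apply' _ _ _ (fun h => hy' h)]
      simpa using hε)
  map_add' f g := by
    ext x
    have := congrFun (Function.extend_add e f g (0 : L → E) 0) x
    simpa using this
  map_smul' c f := by
    ext x
    have := congrFun (Function.extend_smul c e f (0 : L → E)) x
    simpa using this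
  norm_map' f := by
    refine le_antisymm (norm_le_of_forall (norm_nonneg _) fun y => ?_)
      (norm_le_of_forall (norm_nonneg _) fun a => ?_)
    · change ‖Function.extend e f 0 y‖ ≤ _
      by_cases hy' : y ∈ Set.range e
      · obtain ⟨a, rfl⟩ := hy'
        rw [he.injective.extend_apply]
        exact f.norm_apply_le a
      · rw [Function.extend_apply' _ _ _ (fun h => hy' h)]
        simp
    · refine le_trans (le_of_eq ?_) (norm_apply_le _ (e a))
      change _ = ‖Function.extend e f 0 (e a)‖
      rw [he.injective.extend_apply]

theorem extendZero_apply [T2Space L] {e : α → L} (he : IsOpenEmbedding e) (f : C₀(α, E)) (a : α) :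
    extendZero he f (e a) = f a :=
  he.injective.extend_apply _ _ _

theorem extendZero_apply_of_notMem [T2Space L] {e : α → L} (he : IsOpenEmbedding e) (f : C₀(α, E))
    {x : L} (hx : x ∉ Set.range e) : extendZero he f x = 0 :=
  Function.extend_apply' _ _ _ hx

theorem mem_range_extendZero_iff [T2Space L] {e : α → L} (he : IsOpenEmbedding e) (f : C₀(L, E)) :
    f ∈ (extendZero (E := E) he).toLinearMap.range ↔ ∀ x ∉ Set.range e, f x = 0 := by
  constructor
  · rintro ⟨g, rfl⟩ x hx
    exact extendZero_apply_of_notMem he g hx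
  · intro h
    refine ⟨ofBound (f ∘ e) (f.continuous.comp he.continuous) ?_, ?_⟩
    · intro ε hε
      obtain ⟨C, hC, hfC⟩ := f.exists_isCompact hε
      -- The preimage of `C` alone need not be compact; the part of `C` where `f` is at least `ε` is
      -- compact and lies inside the range.
      refine ⟨e ⁻¹' (C ∩ {x | ε ≤ ‖f x‖}), ?_, ?_⟩
      · refine (he.isInducing.isCompact_preimage_iff fun x hx => ?_).mpr
          (hC.inter_right (isClosed_le continuous_const f.continuous.norm))
        by_contra hxe
        have h2 : ε ≤ ‖f x‖ := hx.2
        rw [h x hxe, norm_zero] at h2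
        exact absurd h2 hε.not_ge
      · intro a ha
        by_contra hlt
        rw [not_lt] at hlt
        exact ha ⟨by_contra fun hC => absurd (hfC _ hC) hlt.not_gt, hlt⟩
    · ext x
      by_cases hx : x ∈ Set.range e
      · obtain ⟨a, rfl⟩ := hx
        exact extendZero_apply he _ a
      · rw [h x hx]
        exact extendZero_apply_of_notMem he _ hx

/-- The functions vanishing off the range of an open embedding. -/
noncomputable def vanishEquiv [T2Space L] {e : α → L} (he : IsOpenEmbedding e)
    (p : Submodule ℝ C₀(L, E)) (hp : ∀ f, f ∈ p ↔ ∀ x ∉ Set.range e, f x = 0) :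
    p ≃L[ℝ] C₀(α, E) :=
  ((extendZero (E := E) he).equivRange.toContinuousLinearEquiv.trans
    (ContinuousLinearEquiv.ofEq _ _ (Submodule.ext fun f =>
      (mem_range_extendZero_iff he f).trans (hp f).symm))).symm

end ZeroAtInftyContinuousMap

variable [NormedSpace ℝ E] [NormedSpace ℝ F]

/-- Two extensions of the same quotient, each of which maps to the other one over the quotient,
become isomorphic after adding the other kernel. -/
noncomputable def diagonalEquiv {V : Type*} [AddCommGroup V] [Module ℝ V]
    (q : E →ₗ[ℝ] V) (r : F →ₗ[ℝ] V) (T : E →L[ℝ] F) (U : F →L[ℝ] E)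
    (hT : ∀ x, r (T x) = q x) (hU : ∀ y, q (U y) = r y) :
    (E × LinearMap.ker r) ≃L[ℝ] F × LinearMap.ker q where
  -- Both sides parametrise the pullback `{(x, y) | q x = r y}`: the left by `y = T x + k`, the
  -- right by `x = U y + l`.
  toFun p := (T p.1 + p.2, ⟨p.1 - U (T p.1 + p.2), by
    simp [hT, hU]⟩)
  invFun p := (U p.1 + p.2, ⟨p.1 - T (U p.1 + p.2), by
    simp [hT, hU]⟩)
  map_add' p p' := by
    ext
    · simp; abel
    · simp; abel
  map_smul' c p := by
    ext
    · simp
    · simp [smul_sub]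
  left_inv p := by
    ext <;> simp
  right_inv p := by
    ext <;> simp
  continuous_toFun := by fun_prop
  continuous_invFun := by fun_prop

/-- A space with a complemented copy of `c₀` absorbs `c₀`. -/
noncomputable def absorbEquiv (j : C₀(ℕ, ℝ) →L[ℝ] E) (r : E →L[ℝ] C₀(ℕ, ℝ))
    (h : ∀ z, r (j z) = z) : (E × C₀(ℕ, ℝ)) ≃L[ℝ] E :=
  -- The projection splits `E` as `c₀ ⊕ ker r`, and `c₀ ⊕ c₀` is `c₀`.
  let e := ContinuousLinearEquiv.equivOfRightInverse r j h
  let s : (C₀(ℕ, ℝ) × C₀(ℕ, ℝ)) ≃L[ℝ] C₀(ℕ, ℝ) :=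
    ZeroAtInftyContinuousMap.sumEquiv.symm.trans (ZeroAtInftyContinuousMap.domCongr
      ((Equiv.natSumNatEquivNat.symm.toHomeomorphOfDiscrete)))
  ((e.prodCongr (.refl ℝ _)).trans ((ContinuousLinearEquiv.prodComm ℝ _ _).trans
    ((ContinuousLinearEquiv.prodAssoc ℝ _ _ _).symm.trans (s.prodCongr (.refl ℝ _))))).trans e.symm

/-- A space that absorbs `c₀` absorbs every finite-dimensional space. -/
theorem nonempty_absorb_finiteDimensional (h : Nonempty ((E × C₀(ℕ, ℝ)) ≃L[ℝ] E))
    (V : Type*) [NormedAddCommGroup V] [NormedSpace ℝ V] [FiniteDimensional ℝ V] :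
    Nonempty ((E × V) ≃L[ℝ] E) := by
  obtain ⟨e⟩ := h
  have h1 : Nonempty ((C₀(ℕ, ℝ) × V) ≃L[ℝ] C₀(ℕ, ℝ)) := by
    let n := Module.finrank ℝ V
    let v : V ≃L[ℝ] (Fin n → ℝ) := ContinuousLinearEquiv.ofFinrankEq (by simp [n])
    have k : (Fin n ⊕ ℕ) ≃ ℕ := Classical.choice (Cardinal.eq.mp (by simp))
    exact ⟨(ContinuousLinearEquiv.prodComm ℝ _ _).trans
      (((v.trans ZeroAtInftyContinuousMap.finEquiv.symm).prodCongr (.refl ℝ _)).trans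
      (ZeroAtInftyContinuousMap.sumEquiv.symm.trans
        (ZeroAtInftyContinuousMap.domCongr k.symm.toHomeomorphOfDiscrete)))⟩
  obtain ⟨f⟩ := h1
  exact ⟨((e.symm.prodCongr (.refl ℝ V)).trans ((ContinuousLinearEquiv.prodAssoc ℝ _ _ _).trans
    ((ContinuousLinearEquiv.refl ℝ E).prodCongr f))).trans e⟩

end ZeroAtInftySpaces

/-! ### `Ψ`-spaces and their function spaces -/

section Mrowka

open Filter ZeroAtInftyContinuousMap

/-- The structure of a `Ψ`-space on `L`: every point is either an isolated one, indexed by `D`, or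
one indexed by `I`, which is not isolated but has a compact open neighbourhood all of whose other
points are isolated. -/
structure MrowkaData (D I L : Type*) [TopologicalSpace L] where
  e : D ⊕ I ≃ L
  V : I → Set L
  isOpen_singleton : ∀ n, IsOpen {e (Sum.inl n)}
  not_isOpen_singleton : ∀ i, ¬ IsOpen {e (Sum.inr i)}
  isOpen_V : ∀ i, IsOpen (V i)
  isCompact_V : ∀ i, IsCompact (V i)
  mem_V_iff : ∀ i j, e (Sum.inr j) ∈ V i ↔ j = i

/-- The indicator function of a compact open set. -/
noncomputable def indicatorZeroAtInfty {L : Type*} [TopologicalSpace L] [T2Space L] (V : Set L)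
    (ho : IsOpen V) (hc : IsCompact V) : C₀(L, ℝ) :=
  ofBound (V.indicator 1)
    ((continuous_one (X := L) (M := ℝ)).indicator fun x hx => by
      rw [IsClopen.frontier_eq ⟨hc.isClosed, ho⟩] at hx
      exact hx.elim)
    (fun ε hε => ⟨V, hc, fun x hx => by simpa [hx] using hε⟩)

theorem ZeroAtInftyContinuousMap.sum_apply {L ι : Type*} [TopologicalSpace L] (t : Finset ι)
    (f : ι → C₀(L, ℝ)) (x : L) : (∑ i ∈ t, f i) x = ∑ i ∈ t, f i x := by
  classical
  induction t using Finset.induction_on with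
  | empty => simp
  | insert i t hi ih =>
    rw [Finset.sum_insert hi, Finset.sum_insert hi, ZeroAtInftyContinuousMap.add_apply, ih]

namespace MrowkaData

variable {D I L : Type*} [TopologicalSpace L] (M : MrowkaData D I L)

/-- Renaming the index sets. -/
def reindex {D' I' : Type*} (d : D' ≃ D) (k : I' ≃ I) : MrowkaData D' I' L where
  e := (Equiv.sumCongr d k).trans M.e
  V := M.V ∘ k
  isOpen_singleton n := M.isOpen_singleton (d n)
  not_isOpen_singleton i := M.not_isOpen_singleton (k i)
  isOpen_V i := M.isOpen_V (k i)
  isCompact_V i := M.isCompact_V (k i)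
  mem_V_iff i j := (M.mem_V_iff (k i) (k j)).trans k.injective.eq_iff

/-- The disjoint union of countably many copies of a space. -/
def prodNat : MrowkaData (ℕ × D) (ℕ × I) (ℕ × L) where
  e := (Equiv.prodSumDistrib ℕ D I).symm.trans (Equiv.prodCongr (Equiv.refl ℕ) M.e)
  V p := {p.1} ×ˢ M.V p.2
  isOpen_singleton p := by
    have := (isOpen_discrete ({p.1} : Set ℕ)).prod (M.isOpen_singleton p.2)
    rw [Set.singleton_prod_singleton] at this
    exact this
  not_isOpen_singleton p h := by
    refine M.not_isOpen_singleton p.2 ?_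
    have h' : IsOpen ((fun x : L => (p.1, x)) ⁻¹' {(p.1, M.e (Sum.inr p.2))}) :=
      h.preimage (by fun_prop)
    convert h' using 1
    ext x
    simp
  isOpen_V p := (isOpen_discrete _).prod (M.isOpen_V p.2)
  isCompact_V p := isCompact_singleton.prod (M.isCompact_V p.2)
  mem_V_iff p q := by
    change (q.1, M.e (Sum.inr q.2)) ∈ _ ↔ _
    rw [Set.mem_prod, Set.mem_singleton_iff, M.mem_V_iff, Prod.ext_iff]

/-- The trace on the isolated points of the neighbourhood chosen for a point. -/
def trace (i : I) : Set D := {n | M.e (Sum.inl n) ∈ M.V i}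

/-- A compact set of isolated points is finite. -/
theorem finite_of_isCompact {C : Set L} (hC : IsCompact C) (h : ∀ i, M.e (Sum.inr i) ∉ C) :
    {n | M.e (Sum.inl n) ∈ C}.Finite := by
  obtain ⟨t, ht⟩ := hC.elim_finite_subcover (fun n => {M.e (Sum.inl n)}) M.isOpen_singleton
    (fun x hx => by
      obtain ⟨n | i, rfl⟩ := M.e.surjective x
      · exact Set.mem_iUnion.mpr ⟨n, rfl⟩
      · exact absurd hx (h i))
  refine t.finite_toSet.subset fun n hn => ?_
  obtain ⟨m, hm, hmn⟩ := Set.mem_iUnion₂.mp (ht hn)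
  rw [Set.mem_singleton_iff, M.e.apply_eq_iff_eq, Sum.inl.injEq] at hmn
  exact hmn ▸ hm

/-- Removing a finite trace from `V i` would leave the nonisolated point as an open singleton. -/
theorem infinite_trace [T2Space L] (i : I) : (M.trace i).Infinite := by
  intro hfin
  refine M.not_isOpen_singleton i ?_
  have h1 : IsClosed ((fun n => M.e (Sum.inl n)) '' M.trace i) :=
    (hfin.image _).isClosed
  have h2 := (M.isOpen_V i).sdiff h1
  convert h2 using 1
  ext x
  obtain ⟨n | j, rfl⟩ := M.e.surjective x
  · simp only [Set.mem_singleton_iff, M.e.apply_eq_iff_eq, reduceCtorEq, false_iff]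
    rintro ⟨hn, hn'⟩
    exact hn' ⟨n, hn, rfl⟩
  · simp [M.mem_V_iff]

/-- The intersection of `V i` and `V j` is compact and consists of isolated points. -/
theorem finite_trace_inter_trace [T2Space L] (i j : I) (hij : i ≠ j) :
    (M.trace i ∩ M.trace j).Finite := by
  refine M.finite_of_isCompact ((M.isCompact_V i).inter (M.isCompact_V j)) ?_
  rintro k ⟨hi, hj⟩
  rw [M.mem_V_iff] at hi hj
  exact hij (hi.symm.trans hj)

theorem isOpenEmbedding_comp {ι : Type*} [TopologicalSpace ι] [DiscreteTopology ι] {a : ι → D}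
    (ha : Function.Injective a) : IsOpenEmbedding fun n => M.e (Sum.inl (a n)) := by
  refine IsOpenEmbedding.of_continuous_injective_isOpenMap continuous_of_discreteTopology
    (M.e.injective.comp (Sum.inl_injective.comp ha)) fun s _ => ?_
  rw [← Set.biUnion_of_singleton s, Set.image_iUnion₂]
  refine isOpen_biUnion fun n _ => ?_
  rw [Set.image_singleton]
  exact M.isOpen_singleton _

/-- The restriction of functions to the set of points that are not isolated. -/
def restrict : C₀(L, ℝ) →ₗ[ℝ] (I → ℝ) where
  toFun f i := f (M.e (Sum.inr i))
  map_add' _ _ := rfl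
  map_smul' _ _ := rfl

/-- The functions vanishing at all points that are not isolated form a copy of `c₀`. -/
noncomputable def kerRestrictEquiv [T2Space L] (M : MrowkaData ℕ I L) :
    LinearMap.ker M.restrict ≃L[ℝ] C₀(ℕ, ℝ) :=
  vanishEquiv (M.isOpenEmbedding_comp Function.injective_id) _ fun f => by
    rw [LinearMap.mem_ker, funext_iff]
    constructor
    · intro h x hx
      obtain ⟨n | i, rfl⟩ := M.e.surjective x
      · exact absurd ⟨n, rfl⟩ hx
      · exact h i
    · rintro h i
      refine h _ ?_
      rintro ⟨n, hn⟩
      simp at hn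

/-- The differences of the values of a function along a sequence of isolated points and at its
limit. -/
noncomputable def differences (i : I) {a : ℕ → D} (ha : Function.Injective a)
    (hai : ∀ n, a n ∈ M.trace i) : C₀(L, ℝ) →L[ℝ] C₀(ℕ, ℝ) :=
  LinearMap.mkContinuous
    { toFun := fun f => ofBound (fun n => f (M.e (Sum.inl (a n))) - f (M.e (Sum.inr i)))
        continuous_of_discreteTopology (by
          intro ε hε
          -- This compact set omits the only nonisolated point of `V i`, hence is finite.
          have hC : IsCompact (M.V i ∩ {x | ε ≤ ‖f x - f (M.e (Sum.inr i))‖}) :=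
            (M.isCompact_V i).inter_right
              (isClosed_le continuous_const (f.continuous.sub continuous_const).norm)
          refine ⟨_, ((M.finite_of_isCompact hC ?_).preimage ha.injOn).isCompact, fun n hn => ?_⟩
          · rintro j ⟨hj, hj'⟩
            rw [M.mem_V_iff] at hj
            subst hj
            simp only [sub_self, norm_zero, Set.mem_ofPred_eq] at hj'
            exact hj'.not_gt hε
          · exact not_le.mp fun hle => hn ⟨hai n, hle⟩)
      map_add' := fun f g => ext fun n => add_sub_add_comm _ _ _ _
      map_smul' := fun c f => ext fun n => (mul_sub c _ _).symm } 2
    (fun f => norm_le_of_forall (by positivity) fun n => by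
      refine (norm_sub_le _ _).trans ?_
      rw [two_mul]
      exact add_le_add (f.norm_apply_le _) (f.norm_apply_le _))

/-- An injective sequence in a trace converges to the nonisolated point. Functions supported on the
sequence form a copy of `c₀`, and they vanish at the limit, so taking differences with the value
there is a left inverse of the inclusion. -/
theorem nonempty_absorb [T2Space L] (M : MrowkaData D I L) [Nonempty I] :
    Nonempty ((C₀(L, ℝ) × C₀(ℕ, ℝ)) ≃L[ℝ] C₀(L, ℝ)) := by
  obtain ⟨i⟩ := ‹Nonempty I›
  let b := (M.infinite_trace i).natEmbedding
  have ha : Function.Injective fun n => (b n : D) := Subtype.val_injective.comp b.injective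
  refine ⟨absorbEquiv (extendZero (M.isOpenEmbedding_comp ha)).toContinuousLinearMap
    (M.differences i ha fun n => (b n).2) fun z => ?_⟩
  ext n
  change extendZero (M.isOpenEmbedding_comp ha) z (M.e (Sum.inl (b n))) -
    extendZero (M.isOpenEmbedding_comp ha) z (M.e (Sum.inr i)) = z n
  rw [extendZero_apply (M.isOpenEmbedding_comp ha) z n, extendZero_apply_of_notMem, sub_zero]
  rintro ⟨n, hn⟩
  simp at hn

section Density

variable [T2Space L]

/-- The linear span of the indicator functions of the singletons of isolated points and of the
chosen neighbourhoods. -/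
noncomputable def spanIndicators : Submodule ℝ C₀(L, ℝ) :=
  Submodule.span ℝ
    (Set.range (fun n => indicatorZeroAtInfty _ (M.isOpen_singleton n) isCompact_singleton) ∪
     Set.range (fun i => indicatorZeroAtInfty _ (M.isOpen_V i) (M.isCompact_V i)))

theorem indicator_singleton_mem_spanIndicators (n : D) :
    indicatorZeroAtInfty _ (M.isOpen_singleton n) isCompact_singleton ∈ M.spanIndicators :=
  Submodule.subset_span (Or.inl ⟨n, rfl⟩)

theorem indicator_V_mem_spanIndicators (i : I) :
    indicatorZeroAtInfty _ (M.isOpen_V i) (M.isCompact_V i) ∈ M.spanIndicators :=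
  Submodule.subset_span (Or.inr ⟨i, rfl⟩)

/-- The function that agrees with `g` on a finite set of isolated points and vanishes
elsewhere. -/
theorem exists_mem_spanIndicators_of_finset (t : Finset D) (g : D → ℝ) :
    ∃ f ∈ M.spanIndicators, (∀ n ∈ t, f (M.e (Sum.inl n)) = g n) ∧
      (∀ n, n ∉ t → f (M.e (Sum.inl n)) = 0) ∧ ∀ i, f (M.e (Sum.inr i)) = 0 := by
  classical
  have key : ∀ x, (∑ m ∈ t, g m •
      indicatorZeroAtInfty _ (M.isOpen_singleton m) isCompact_singleton : C₀(L, ℝ)) x =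
      ∑ m ∈ t, g m * ({M.e (Sum.inl m)} : Set L).indicator 1 x := fun x => by
    rw [ZeroAtInftyContinuousMap.sum_apply]
    rfl
  refine ⟨∑ m ∈ t, g m • indicatorZeroAtInfty _ (M.isOpen_singleton m) isCompact_singleton,
    Submodule.sum_mem _ fun m _ =>
      Submodule.smul_mem _ _ (M.indicator_singleton_mem_spanIndicators m), ?_, ?_, ?_⟩
  · intro n hn
    rw [key, Finset.sum_eq_single_of_mem n hn]
    · simp
    · intro m _ hmn
      simp [hmn.symm]
  · intro n hn
    rw [key, Finset.sum_eq_zero]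
    intro m hm
    have : n ≠ m := fun h => hn (h ▸ hm)
    simp [this]
  · intro i
    rw [key, Finset.sum_eq_zero]
    intro m _
    simp

/-- Finitely many indicators of the `V i` correct `f` at the nonisolated points where it is large.
What remains is at least `ε` only on a compact set of isolated points, thus at finitely many, and
singletons remove these. -/
theorem exists_mem_spanIndicators_norm_sub_le (f : C₀(L, ℝ)) {ε : ℝ} (hε : 0 < ε) :
    ∃ g ∈ M.spanIndicators, ‖f - g‖ ≤ ε := by
  classical
  obtain ⟨C, hC, hfC⟩ := f.exists_isCompact hε
  let U : D ⊕ I → Set L := Sum.elim (fun n => {M.e (Sum.inl n)}) M.V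
  obtain ⟨t, ht⟩ := hC.elim_finite_subcover U
    (by rintro (n | i); exacts [M.isOpen_singleton n, M.isOpen_V i])
    (fun x _ => by
      obtain ⟨n | i, rfl⟩ := M.e.surjective x
      · exact Set.mem_iUnion.mpr ⟨Sum.inl n, rfl⟩
      · exact Set.mem_iUnion.mpr ⟨Sum.inr i, (M.mem_V_iff i i).mpr rfl⟩)
  let F : Finset I := t.preimage Sum.inr Sum.inr_injective.injOn
  let h : C₀(L, ℝ) := ∑ i ∈ F, f (M.e (Sum.inr i)) •
    indicatorZeroAtInfty _ (M.isOpen_V i) (M.isCompact_V i)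
  have hmem : h ∈ M.spanIndicators := Submodule.sum_mem _ fun i _ =>
    Submodule.smul_mem _ _ (M.indicator_V_mem_spanIndicators i)
  have hh : ∀ x, h x = ∑ i ∈ F, f (M.e (Sum.inr i)) * (M.V i).indicator 1 x := fun x => by
    rw [ZeroAtInftyContinuousMap.sum_apply]
    rfl
  have hsmall : ∀ j, ‖(f - h) (M.e (Sum.inr j))‖ < ε := by
    intro j
    rw [ZeroAtInftyContinuousMap.sub_apply, hh]
    by_cases hj : j ∈ F
    · rw [Finset.sum_eq_single_of_mem j hj]
      · rw [Set.indicator_of_mem ((M.mem_V_iff j j).mpr rfl)]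
        simpa using hε
      · intro i _ hij
        rw [Set.indicator_of_notMem (fun hmem => hij ((M.mem_V_iff i j).mp hmem).symm), mul_zero]
    · rw [Finset.sum_eq_zero, sub_zero]
      · refine hfC _ fun hjC => ?_
        obtain ⟨n | i, hmem, hx⟩ := Set.mem_iUnion₂.mp (ht hjC)
        · have hx' : M.e (Sum.inr j) = M.e (Sum.inl n) := hx
          simp at hx'
        · have hji : j = i := (M.mem_V_iff i j).mp hx
          exact hj (Finset.mem_preimage.mpr (hji ▸ hmem))
      · intro i hi
        rw [Set.indicator_of_notMem, mul_zero]
        rw [M.mem_V_iff]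
        rintro rfl
        exact hj hi
  obtain ⟨C', hC', hC'f⟩ := (f - h).exists_isCompact hε
  have hfin := M.finite_of_isCompact (hC'.inter_right
    (isClosed_le (continuous_const (y := ε)) (f - h).continuous.norm))
    (fun j hj => (hsmall j).not_ge hj.2)
  obtain ⟨g, hg, hgt, hgt', hgI⟩ := M.exists_mem_spanIndicators_of_finset hfin.toFinset
    fun n => (f - h) (M.e (Sum.inl n))
  refine ⟨h + g, Submodule.add_mem _ hmem hg, norm_le_of_forall hε.le fun x => ?_⟩
  rw [← sub_sub, ZeroAtInftyContinuousMap.sub_apply]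
  obtain ⟨n | i, rfl⟩ := M.e.surjective x
  · by_cases hn : n ∈ hfin.toFinset
    · rw [hgt n hn, sub_self, norm_zero]
      exact hε.le
    · rw [hgt' n hn, sub_zero]
      by_contra hlt
      refine hn (hfin.mem_toFinset.mpr ⟨?_, (not_le.mp hlt).le⟩)
      by_contra hnC
      exact hlt (hC'f _ hnC).le
  · rw [hgI, sub_zero]
    exact (hsmall i).le

end Density

section Transfer

variable {L' : Type*} [TopologicalSpace L'] (M : MrowkaData ℕ I L) (M' : MrowkaData ℕ I L')
  (S : ℕ → Finset ℕ)

/-- The map of functions that sums values over the sets `S n`. -/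
def transferFun : (L → ℝ) →ₗ[ℝ] (L' → ℝ) where
  toFun f y := Sum.elim (fun n => ∑ m ∈ S n, f (M.e (Sum.inl m)))
    (fun i => f (M.e (Sum.inr i))) (M'.e.symm y)
  map_add' f g := by
    ext y
    rcases h : M'.e.symm y with n | i <;> simp [h, Finset.sum_add_distrib]
  map_smul' c f := by
    ext y
    rcases h : M'.e.symm y with n | i <;> simp [h, Finset.mul_sum]

@[simp] theorem transferFun_inl (f : L → ℝ) (n : ℕ) :
    M.transferFun M' S f (M'.e (Sum.inl n)) = ∑ m ∈ S n, f (M.e (Sum.inl m)) := by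
  simp [transferFun]

@[simp] theorem transferFun_inr (f : L → ℝ) (i : I) :
    M.transferFun M' S f (M'.e (Sum.inr i)) = f (M.e (Sum.inr i)) := by
  simp [transferFun]

variable {S}

theorem norm_transferFun_le (hS : ∀ n, (S n).card ≤ 2) (f : C₀(L, ℝ)) (y : L') :
    ‖M.transferFun M' S f y‖ ≤ 2 * ‖f‖ := by
  obtain ⟨n | i, rfl⟩ := M'.e.surjective y
  · rw [transferFun_inl]
    refine (norm_sum_le_of_le _ fun m _ => f.norm_apply_le _).trans ?_
    rw [Finset.sum_const, nsmul_eq_mul]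
    have : ((S n).card : ℝ) ≤ 2 := by exact_mod_cast hS n
    exact mul_le_mul_of_nonneg_right this (norm_nonneg _)
  · rw [transferFun_inr]
    linarith [f.norm_apply_le (M.e (Sum.inr i)), norm_nonneg f]

variable [T2Space L] [T2Space L']

/-- On the indicator of `V i` the sum over `S n` counts the points of `S n` in the trace, so the
result is the indicator of the corresponding neighbourhood in `L'` up to finitely many isolated
points. Density of the span and the norm bound `2` extend this to all functions. -/
theorem exists_coe_eq_transferFun (hS : ∀ n, (S n).card ≤ 2) (hSn : ∀ n, ∀ m ∈ S n, n ≤ m)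
    (hSi : ∀ i, ∃ N, ∀ n, N ≤ n → MeetsAccording (M.trace i) (M'.trace i) n (S n))
    (f : C₀(L, ℝ)) : ∃ g : C₀(L', ℝ), ⇑g = M.transferFun M' S f := by
  classical
  let W : Submodule ℝ C₀(L, ℝ) :=
    { carrier := {f | ∃ g : C₀(L', ℝ), ⇑g = M.transferFun M' S f}
      zero_mem' := ⟨0, by rw [coe_zero, coe_zero, map_zero]⟩
      add_mem' := by
        rintro f₁ f₂ ⟨g₁, h₁⟩ ⟨g₂, h₂⟩
        exact ⟨g₁ + g₂, by rw [coe_add, coe_add, map_add, h₁, h₂]⟩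
      smul_mem' := by
        rintro c f₁ ⟨g₁, h₁⟩
        exact ⟨c • g₁, by rw [coe_smul, coe_smul, map_smul, h₁]⟩ }
  have hfin : ∀ (h : C₀(L', ℝ)) (g : L' → ℝ) (N : ℕ),
      (∀ n, N ≤ n → g (M'.e (Sum.inl n)) = h (M'.e (Sum.inl n))) →
      (∀ i, g (M'.e (Sum.inr i)) = h (M'.e (Sum.inr i))) → ∃ k : C₀(L', ℝ), ⇑k = g := by
    intro h g N hN hI
    obtain ⟨k, -, hk1, hk2, hk3⟩ := M'.exists_mem_spanIndicators_of_finset (Finset.range N)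
      fun n => g (M'.e (Sum.inl n)) - h (M'.e (Sum.inl n))
    refine ⟨h + k, funext fun y => ?_⟩
    rw [ZeroAtInftyContinuousMap.add_apply]
    obtain ⟨n | i, rfl⟩ := M'.e.surjective y
    · by_cases hn : n < N
      · rw [hk1 n (Finset.mem_range.mpr hn)]
        ring
      · rw [hk2 n (fun h => hn (Finset.mem_range.mp h)), hN n (not_lt.mp hn), add_zero]
    · rw [hk3, hI, add_zero]
  have hW : M.spanIndicators ≤ W := by
    refine Submodule.span_le.mpr ?_
    rintro _ (⟨m, rfl⟩ | ⟨i, rfl⟩)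
    -- Since `S n` lies in `[n, ∞)`, the point `m` belongs to no `S n` with `n > m`.
    · refine hfin 0 _ (m + 1) (fun n hn => ?_) fun i => ?_
      · rw [transferFun_inl, ZeroAtInftyContinuousMap.zero_apply]
        refine Finset.sum_eq_zero fun k hk => ?_
        have hkm : k ≠ m := by
          have := hSn n k hk
          omega
        simp [indicatorZeroAtInfty, hkm]
      · rw [transferFun_inr]
        simp [indicatorZeroAtInfty]
    · obtain ⟨N, hN⟩ := hSi i
      refine hfin (indicatorZeroAtInfty _ (M'.isOpen_V i) (M'.isCompact_V i)) _ N
        (fun n hn => ?_) fun j => ?_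
      · have h := hN n hn
        unfold MeetsAccording at h
        rw [transferFun_inl]
        have h1 : ∀ m, (indicatorZeroAtInfty _ (M.isOpen_V i) (M.isCompact_V i))
            (M.e (Sum.inl m)) = if m ∈ M.trace i then (1 : ℝ) else 0 := fun m => by
          simp only [indicatorZeroAtInfty, trace, ofBound_apply, Set.indicator_apply, Pi.one_apply,
            Set.mem_ofPred_eq]
          congr
        have h2 : (indicatorZeroAtInfty _ (M'.isOpen_V i) (M'.isCompact_V i))
            (M'.e (Sum.inl n)) = if n ∈ M'.trace i then (1 : ℝ) else 0 := by
          simp only [indicatorZeroAtInfty, trace, ofBound_apply, Set.indicator_apply, Pi.one_apply,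
            Set.mem_ofPred_eq]
          congr
        rw [Finset.sum_congr rfl fun m _ => h1 m, h2, Finset.sum_boole]
        have h3 : ({m ∈ S n | m ∈ M.trace i}.card : ℝ) =
            ((if n ∈ M'.trace i then 1 else 0 : ℕ) : ℝ) := by
          convert congrArg (Nat.cast (R := ℝ)) h
        rw [h3]
        push_cast
        rfl
      · rw [transferFun_inr]
        simp [indicatorZeroAtInfty, Set.indicator_apply, mem_V_iff]
  refine exists_coe_eq_of_approx fun ε hε => ?_
  -- The error is at most doubled, and `2ε/3 < ε`.
  obtain ⟨f', hf', hle⟩ := M.exists_mem_spanIndicators_norm_sub_le f (ε := ε / 3) (by positivity)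
  obtain ⟨g, hg⟩ := hW hf'
  refine ⟨g, fun y => ?_⟩
  have h := M.norm_transferFun_le M' hS (f - f') y
  rw [coe_sub, map_sub, Pi.sub_apply] at h
  rw [hg]
  linarith

/-- The operator that sums values over the sets `S n`. -/
noncomputable def transfer (hS : ∀ n, (S n).card ≤ 2) (hSn : ∀ n, ∀ m ∈ S n, n ≤ m)
    (hSi : ∀ i, ∃ N, ∀ n, N ≤ n → MeetsAccording (M.trace i) (M'.trace i) n (S n)) :
    C₀(L, ℝ) →L[ℝ] C₀(L', ℝ) :=
  have h := M.exists_coe_eq_transferFun M' hS hSn hSi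
  LinearMap.mkContinuous
    { toFun := fun f => (h f).choose
      map_add' := fun f g => DFunLike.coe_injective (by
        rw [(h _).choose_spec, coe_add, coe_add, map_add, (h _).choose_spec, (h _).choose_spec])
      map_smul' := fun c f => DFunLike.coe_injective (by
        rw [(h _).choose_spec, coe_smul, RingHom.id_apply, coe_smul, map_smul,
          (h _).choose_spec]) } 2
    (fun f => norm_le_of_forall (by positivity) fun y => by
      change ‖(h f).choose y‖ ≤ _
      rw [(h f).choose_spec]
      exact M.norm_transferFun_le M' hS f y)

theorem restrict_transfer (hS : ∀ n, (S n).card ≤ 2) (hSn : ∀ n, ∀ m ∈ S n, n ≤ m)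
    (hSi : ∀ i, ∃ N, ∀ n, N ≤ n → MeetsAccording (M.trace i) (M'.trace i) n (S n))
    (f : C₀(L, ℝ)) : M'.restrict (M.transfer M' hS hSn hSi f) = M.restrict f := by
  ext i
  have h := (M.exists_coe_eq_transferFun M' hS hSn hSi f).choose_spec
  exact (congrFun h _).trans (M.transferFun_inr M' S f i)

end Transfer

end MrowkaData

/-- Under Martin's axiom, any two `Ψ`-spaces with the same number of points that are not isolated
have isomorphic spaces of continuous functions vanishing at infinity. -/
theorem MartinsAxiom.nonempty_zeroAtInfty_equiv {κ : Cardinal.{u}} (hMA : MartinsAxiom κ)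
    (hκ : ℵ₀ ≤ κ) {I : Type u} [Nonempty I] (hI : #I ≤ κ) {L L' : Type*} [TopologicalSpace L]
    [TopologicalSpace L'] [T2Space L] [T2Space L']
    (M : MrowkaData ℕ I L) (M' : MrowkaData ℕ I L') :
    Nonempty (C₀(L, ℝ) ≃L[ℝ] C₀(L', ℝ)) := by
  obtain ⟨S, hS, hSn, hSi⟩ := hMA.exists_transfer hκ hI M.infinite_trace
    M.finite_trace_inter_trace M'.finite_trace_inter_trace
  obtain ⟨S', hS', hSn', hSi'⟩ := hMA.exists_transfer hκ hI M'.infinite_trace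
    M'.finite_trace_inter_trace M.finite_trace_inter_trace
  obtain ⟨a⟩ := M.nonempty_absorb
  obtain ⟨a'⟩ := M'.nonempty_absorb
  have d := diagonalEquiv M.restrict M'.restrict (M.transfer M' hS hSn hSi)
    (M'.transfer M hS' hSn' hSi') (M.restrict_transfer M' hS hSn hSi)
    (M'.restrict_transfer M hS' hSn' hSi')
  exact ⟨a.symm.trans ((((ContinuousLinearEquiv.refl ℝ _).prodCongr
    M'.kerRestrictEquiv.symm).trans (d.trans ((ContinuousLinearEquiv.refl ℝ _).prodCongr
    M.kerRestrictEquiv))).trans a')⟩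

end Mrowka

/-! ### Compact spaces of height three and their `Ψ`-space part -/

section Scattered

open ZeroAtInftyContinuousMap CantorBendixson

/-- On a compact space all continuous functions vanish at infinity. -/
noncomputable def continuousMapEquivZeroAtInfty (K : Type*) [TopologicalSpace K] [CompactSpace K] :
    C(K, ℝ) ≃L[ℝ] C₀(K, ℝ) :=
  LinearEquiv.toContinuousLinearEquivOfBounds
    { toFun := fun f => ofBound f f.continuous
        (fun _ _ => ⟨Set.univ, isCompact_univ, fun x hx => absurd (Set.mem_univ x) hx⟩)
      invFun := fun f => f.toContinuousMap
      map_add' := fun _ _ => rfl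
      map_smul' := fun _ _ => rfl
      left_inv := fun f => rfl
      right_inv := fun f => rfl } 1 1
    (fun f => by
      rw [one_mul]
      exact norm_le_of_forall (norm_nonneg _) fun x => f.norm_coe_le_norm x)
    (fun f => by
      rw [one_mul]
      exact (ContinuousMap.norm_le _ (norm_nonneg _)).mpr fun x => f.norm_apply_le x)

/-- Functions on a compact space, up to a finite-dimensional summand, are functions on the
complement of a finite set. -/
theorem exists_finiteDimensional_prod_equiv {K : Type*} [TopologicalSpace K] [CompactSpace K]
    [T2Space K] {s : Set K} (hs : s.Finite) :
    ∃ V : Submodule ℝ C₀(K, ℝ), FiniteDimensional ℝ V ∧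
      Nonempty (C(K, ℝ) ≃L[ℝ] C₀((sᶜ : Set K), ℝ) × V) := by
  have := hs.to_subtype
  have := Fintype.ofFinite s
  let R₀ : C₀(K, ℝ) →ₗ[ℝ] (s → ℝ) :=
    { toFun := fun f x => f x
      map_add' := fun _ _ => rfl
      map_smul' := fun _ _ => rfl }
  let R : C₀(K, ℝ) →L[ℝ] (s → ℝ) := R₀.mkContinuous 1 (fun f => by
    rw [one_mul]
    exact (pi_norm_le_iff_of_nonneg (norm_nonneg _)).mpr fun x => f.norm_apply_le x)
  -- `V` complements the functions that vanish on `s`; restriction to `s` is injective on it, so its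
  -- dimension is finite.
  obtain ⟨V, hV⟩ := R.ker_closedComplemented_of_finiteDimensional_range.exists_isTopCompl
  have hinj : Function.Injective ((R : C₀(K, ℝ) →ₗ[ℝ] (s → ℝ)).comp V.subtype) := by
    intro f g hfg
    have h : (f : C₀(K, ℝ)) - g ∈ R.ker ⊓ V := by
      refine ⟨?_, V.sub_mem f.2 g.2⟩
      exact (map_sub R _ _).trans (sub_eq_zero.mpr hfg)
    rw [hV.isCompl.inf_eq_bot] at h
    exact Subtype.ext (sub_eq_zero.mp h)
  refine ⟨V, FiniteDimensional.of_injective _ hinj,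
    ⟨(continuousMapEquivZeroAtInfty K).trans ((Submodule.prodEquivOfIsTopCompl _ _ hV).symm.trans
      ((vanishEquiv hs.isClosed.isOpen_compl.isOpenEmbedding_subtypeVal _ fun f => ?_).prodCongr
        (.refl ℝ V)))⟩⟩
  rw [LinearMap.mem_ker, Subtype.range_val]
  constructor
  · intro h x hx
    exact congrFun h ⟨x, not_not.mp hx⟩
  · intro h
    funext x
    exact h x fun hx => hx x.2

variable {K : Type u} [TopologicalSpace K]

theorem iteratedDerivedSet_of_scatteredHeight_eq_three (h : scatteredHeight K = 3) :
    (relDerivedSet (relDerivedSet (Set.univ : Set K))).Nonempty ∧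
      relDerivedSet (relDerivedSet (relDerivedSet (Set.univ : Set K))) = ∅ := by
  have h2 : iteratedDerivedSet (Set.univ : Set K) (2 : Ordinal.{u}) =
      relDerivedSet (relDerivedSet (Set.univ : Set K)) := by
    rw [← one_add_one_eq_two, iteratedDerivedSet_succ, ← zero_add (1 : Ordinal.{u}),
      iteratedDerivedSet_succ, iteratedDerivedSet_zero]
  have h3 : iteratedDerivedSet (Set.univ : Set K) (3 : Ordinal.{u}) =
      relDerivedSet (relDerivedSet (relDerivedSet (Set.univ : Set K))) := by
    rw [← two_add_one_eq_three, iteratedDerivedSet_succ, h2]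
  unfold scatteredHeight at h
  constructor
  · rw [← h2, Set.nonempty_iff_ne_empty]
    intro hempty
    have := csInf_le' (show (2 : Ordinal.{u}) ∈ {α : Ordinal.{u} |
      iteratedDerivedSet (Set.univ : Set K) α = ∅} from hempty)
    rw [h] at this
    exact absurd this (by norm_num)
  · rw [← h3, ← h]
    refine csInf_mem (s := {α : Ordinal.{u} | iteratedDerivedSet (Set.univ : Set K) α = ∅}) ?_
    -- If no derivative were empty, the infimum would take its default value `0`, not `3`.
    by_contra hne
    rw [Set.not_nonempty_iff_eq_empty] at hne
    rw [hne, Ordinal.sInf_empty] at h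
    exact absurd h (by norm_num)

theorem notMem_relDerivedSet_iff {s : Set K} {x : K} (hx : x ∈ s) :
    x ∉ relDerivedSet s ↔ ∃ U : Set K, IsOpen U ∧ U ∩ s = {x} := by
  simp only [relDerivedSet_apply, Set.mem_inter_iff, hx, and_true, mem_derivedSet,
    accPt_iff_nhds, not_forall, not_exists, not_and, not_not]
  constructor
  · rintro ⟨W, hW, h⟩
    obtain ⟨U, hUW, hU, hxU⟩ := mem_nhds_iff.mp hW
    refine ⟨U, hU, Set.Subset.antisymm (fun y hy => h y ⟨hUW hy.1, hy.2⟩) ?_⟩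
    rintro _ rfl
    exact ⟨hxU, hx⟩
  · rintro ⟨U, hU, h⟩
    have hxU : x ∈ U := (h.ge rfl : x ∈ U ∩ s).1
    exact ⟨U, hU.mem_nhds hxU, fun y hy => h.le hy⟩

theorem notMem_relDerivedSet_univ_iff {x : K} :
    x ∉ relDerivedSet (Set.univ : Set K) ↔ IsOpen ({x} : Set K) := by
  rw [notMem_relDerivedSet_iff (Set.mem_univ x)]
  simp only [Set.inter_univ, exists_eq_right]

theorem isClosed_relDerivedSet [T1Space K] {s : Set K} (hs : IsClosed s) :
    IsClosed (relDerivedSet s) := by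
  have h := isClosed_iteratedDerivedSet hs (0 + 1)
  rwa [iteratedDerivedSet_succ, iteratedDerivedSet_zero] at h

theorem finite_of_relDerivedSet_eq_empty [CompactSpace K] {s : Set K} (hs : IsClosed s)
    (h : relDerivedSet s = ∅) : s.Finite := by
  by_contra hinf
  obtain ⟨x, hx, hacc⟩ := Set.Infinite.exists_accPt_of_subset_isCompact hinf hs.isCompact
    subset_rfl
  have : x ∈ relDerivedSet s := ⟨hacc, hx⟩
  rw [h] at this
  exact this

/-- Otherwise `s` itself would be finite, hence discrete, and have no accumulation points. -/
theorem infinite_diff_of_finite_relDerivedSet [T1Space K] {s : Set K}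
    (hne : (relDerivedSet s).Nonempty) (hfin : (relDerivedSet s).Finite) :
    (s \ relDerivedSet s).Infinite := by
  intro h
  have hs : s.Finite := (h.union hfin).subset fun x hx => by
    by_cases hx' : x ∈ relDerivedSet s
    · exact Or.inr hx'
    · exact Or.inl ⟨hx, hx'⟩
  obtain ⟨x, hx⟩ := hne
  refine (notMem_relDerivedSet_iff hx.2).mpr ⟨(s \ {x})ᶜ, ?_, ?_⟩ hx
  · exact (hs.subset Set.sdiff_subset).isClosed.isOpen_compl
  · ext y
    simp only [Set.mem_inter_iff, Set.mem_compl_iff, Set.mem_sdiff, Set.mem_singleton_iff]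
    constructor
    · rintro ⟨h1, h2⟩
      exact not_not.mp fun h => h1 ⟨h2, h⟩
    · rintro rfl
      exact ⟨fun h => h.2 rfl, hx.2⟩

/-- The points of the first derived set which are not in the second one have arbitrarily small
clopen neighbourhoods that contain no further points of the first derived set. -/
theorem exists_isCompact_isOpen_inter_relDerivedSet [CompactSpace K] [T2Space K] {x : K}
    (hx : x ∈ relDerivedSet (Set.univ : Set K))
    (hx' : x ∉ relDerivedSet (relDerivedSet (Set.univ : Set K))) :
    ∃ C : Set K, IsCompact C ∧ IsOpen C ∧ C ∩ relDerivedSet (Set.univ : Set K) = {x} := by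
  obtain ⟨U, hU, hUx⟩ := (notMem_relDerivedSet_iff hx).mp hx'
  have hxU : x ∈ U := (hUx.ge rfl : x ∈ U ∩ _).1
  obtain ⟨C, hC, hxC, hCU⟩ := exists_compact_subset hU hxU
  refine ⟨C, hC, ?_, Set.Subset.antisymm (fun y hy => hUx.le ⟨hCU hy.1, hy.2⟩) ?_⟩
  -- A compact neighbourhood of `x` is already open here, as all its other points are isolated in
  -- `K`.
  · rw [isOpen_iff_mem_nhds]
    intro y hy
    by_cases hy' : y ∈ relDerivedSet (Set.univ : Set K)
    · have : y = x := hUx.le ⟨hCU hy, hy'⟩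
      rw [this]
      exact mem_interior_iff_mem_nhds.mp hxC
    · exact Filter.mem_of_superset
        ((notMem_relDerivedSet_univ_iff.mp hy').mem_nhds rfl) (Set.singleton_subset_iff.mpr hy)
  · rintro _ rfl
    exact ⟨interior_subset hxC, hx⟩

/-- The complement of the second derived set of a compact space is a `Ψ`-space. -/
theorem nonempty_mrowkaData_compl_relDerivedSet [CompactSpace K] [T2Space K] :
    Nonempty (MrowkaData ((relDerivedSet (Set.univ : Set K))ᶜ : Set K)
      (relDerivedSet (Set.univ : Set K) \ relDerivedSet (relDerivedSet (Set.univ : Set K)) : Set K)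
      ((relDerivedSet (relDerivedSet (Set.univ : Set K)))ᶜ : Set K)) := by
  set s := relDerivedSet (Set.univ : Set K) with hs
  have hclosed : IsClosed (relDerivedSet s) :=
    isClosed_relDerivedSet (isClosed_relDerivedSet isClosed_univ)
  choose C hC hCo hCs using fun x : (s \ relDerivedSet s : Set K) =>
    exists_isCompact_isOpen_inter_relDerivedSet x.2.1 x.2.2
  classical
  have hsub : ∀ i, C i ⊆ (relDerivedSet s)ᶜ := fun i y hy hy' => by
    have : y = i := (hCs i).le ⟨hy, hy'.2⟩
    exact i.2.2 (this ▸ hy')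
  let f : (sᶜ : Set K) ⊕ (s \ relDerivedSet s : Set K) → ((relDerivedSet s)ᶜ : Set K) :=
    Sum.elim (fun x => ⟨x, fun h => x.2 h.2⟩) (fun x => ⟨x, x.2.2⟩)
  have hf : Function.Bijective f := by
    constructor
    · rintro (x | x) (y | y) hxy
      · have h := congrArg Subtype.val hxy
        exact congrArg Sum.inl (Subtype.ext h)
      · have h : (x : K) = y := congrArg Subtype.val hxy
        exact absurd (h ▸ y.2.1) x.2
      · have h : (x : K) = y := congrArg Subtype.val hxy
        exact absurd (h ▸ x.2.1) y.2
      · have h := congrArg Subtype.val hxy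
        exact congrArg Sum.inr (Subtype.ext h)
    · rintro ⟨x, hx⟩
      by_cases hxs : x ∈ s
      · exact ⟨Sum.inr ⟨x, hxs, hx⟩, rfl⟩
      · exact ⟨Sum.inl ⟨x, hxs⟩, rfl⟩
  have hval : ∀ x : ((relDerivedSet s)ᶜ : Set K), IsOpen {x} ↔ IsOpen {(x : K)} := fun x => by
    rw [hclosed.isOpen_compl.isOpenEmbedding_subtypeVal.isOpen_iff_image_isOpen,
      Set.image_singleton]
  refine ⟨⟨Equiv.ofBijective f hf, fun i => Subtype.val ⁻¹' C i, fun x => ?_, fun x => ?_,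
    fun i => (hCo i).preimage continuous_subtype_val, fun i => ?_, fun i j => ?_⟩⟩
  · exact (hval _).mpr (notMem_relDerivedSet_univ_iff.mp x.2)
  · rw [hval]
    exact fun h => notMem_relDerivedSet_univ_iff.mpr h x.2.1
  · rw [Subtype.isCompact_iff, Subtype.image_preimage_coe, Set.inter_eq_right.mpr (hsub i)]
    exact hC i
  · change (j : K) ∈ C i ↔ _
    constructor
    · intro h
      exact Subtype.ext ((hCs i).le ⟨h, j.2.1⟩)
    · rintro rfl
      exact ((hCs j).ge rfl).1

/-- A basic set between `x` and its isolating neighbourhood `C x` determines `x`. -/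
theorem mk_le_topologicalWeight [CompactSpace K] [T2Space K] :
    #(relDerivedSet (Set.univ : Set K) \ relDerivedSet (relDerivedSet (Set.univ : Set K)) : Set K)
      ≤ topologicalWeight K := by
  refine le_csInf ⟨_, _, TopologicalSpace.isTopologicalBasis_opens, rfl⟩ ?_
  rintro _ ⟨B, hB, rfl⟩
  choose C hC hCo hCs using fun x : (relDerivedSet (Set.univ : Set K) \
    relDerivedSet (relDerivedSet (Set.univ : Set K)) : Set K) =>
    exists_isCompact_isOpen_inter_relDerivedSet x.2.1 x.2.2
  have h : ∀ x : (relDerivedSet (Set.univ : Set K) \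
      relDerivedSet (relDerivedSet (Set.univ : Set K)) : Set K), ∃ b ∈ B, (x : K) ∈ b ∧ b ⊆ C x :=
    fun x =>
    hB.exists_subset_of_mem_open ((hCs x).ge rfl).1 (hCo x)
  choose b hb hxb hbC using h
  refine mk_le_of_injective (f := fun x => (⟨b x, hb x⟩ : B)) fun x y hxy => ?_
  have hbxy : b x = b y := congrArg Subtype.val hxy
  exact Subtype.ext ((hCs y).le ⟨hbC y (hbxy ▸ hxb x), x.2.1⟩)

/-- Every dense set contains all isolated points. -/
theorem countable_compl_relDerivedSet_univ [TopologicalSpace.SeparableSpace K] :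
    ((relDerivedSet (Set.univ : Set K))ᶜ : Set K).Countable := by
  obtain ⟨s, hs, hd⟩ := TopologicalSpace.exists_countable_dense K
  refine hs.mono fun x hx => ?_
  obtain ⟨y, hy, rfl⟩ := hd.exists_mem_open (notMem_relDerivedSet_univ_iff.mp hx)
    (Set.singleton_nonempty x)
  exact hy

/-- A `c₀`-sum absorbs one further summand. -/
noncomputable def zeroAtInftyNatProdEquiv (E : Type*) [NormedAddCommGroup E] [NormedSpace ℝ E] :
    (C₀(ℕ, E) × E) ≃L[ℝ] C₀(ℕ, E) :=
  ((ContinuousLinearEquiv.refl ℝ _).prodCongr punitEquiv.symm).trans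
    (sumEquiv.symm.trans (domCongr Equiv.natSumPUnitEquivNat.symm.toHomeomorphOfDiscrete))

end Scattered

/-! ### The main theorem -/

theorem mainTheorem10 (κ : Cardinal.{u}) (hMA : MartinsAxiom κ)
    (K : Type u) [TopologicalSpace K] [CompactSpace K] [T2Space K]
    [TopologicalSpace.SeparableSpace K] (hscattered : IsScattered K)
    (hheight : scatteredHeight K = 3) (hweight : topologicalWeight K = κ) :
    Nonempty (C0Sum C(K, ℝ) ≃L[ℝ] C(K, ℝ)) ∧
      Nonempty (C(K, ℝ) ≃L[ℝ] C(K, ℝ) × C(K, ℝ)) := by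
  obtain ⟨hne, hempty⟩ := iteratedDerivedSet_of_scatteredHeight_eq_three hheight
  set s := relDerivedSet (Set.univ : Set K)
  have hfin : (relDerivedSet s).Finite := finite_of_relDerivedSet_eq_empty
    (isClosed_relDerivedSet (isClosed_relDerivedSet isClosed_univ)) hempty
  have hI : Infinite (s \ relDerivedSet s : Set K) :=
    (infinite_diff_of_finite_relDerivedSet hne hfin).to_subtype
  have hIκ : #(s \ relDerivedSet s : Set K) ≤ κ := hweight ▸ mk_le_topologicalWeight
  obtain ⟨M₀⟩ := nonempty_mrowkaData_compl_relDerivedSet (K := K)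
  have hD : Infinite (sᶜ : Set K) :=
    Infinite.of_injective _ ((M₀.infinite_trace (Classical.arbitrary _)).natEmbedding.trans
      (Function.Embedding.subtype _)).injective
  have hDc : Countable (sᶜ : Set K) := countable_compl_relDerivedSet_univ.to_subtype
  obtain ⟨d⟩ : Nonempty (ℕ ≃ (sᶜ : Set K)) := nonempty_equiv_of_countable
  obtain ⟨k⟩ : Nonempty ((s \ relDerivedSet s : Set K) ≃ ℕ × (s \ relDerivedSet s : Set K)) :=
    Cardinal.eq.mp (by
      rw [mk_prod, mk_nat, Cardinal.lift_aleph0, Cardinal.lift_uzero,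
        aleph0_mul_eq (aleph0_le_mk _)])
  have M := M₀.reindex d (Equiv.refl _)
  -- `ℕ × L` is a `Ψ`-space over the same index sets as `L`, so Martin's axiom identifies their
  -- function spaces.
  have M' := M.prodNat.reindex Nat.pairEquiv.symm k
  obtain ⟨e⟩ := hMA.nonempty_zeroAtInfty_equiv ((aleph0_le_mk _).trans hIκ) hIκ M' M
  obtain ⟨V, _, ⟨v⟩⟩ := exists_finiteDimensional_prod_equiv hfin
  obtain ⟨w⟩ := nonempty_absorb_finiteDimensional M.nonempty_absorb V
  have f := v.trans w
  have g : C₀(ℕ, C(K, ℝ)) ≃L[ℝ] C(K, ℝ) :=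
    (ZeroAtInftyContinuousMap.codCongr f).trans
      (ZeroAtInftyContinuousMap.curryEquiv.symm.trans (e.trans f.symm))
  -- With `E = C(K)`: `E ≅ c₀(E) ≅ c₀(E) ⊕ E ≅ E ⊕ E`.
  exact ⟨⟨g⟩, ⟨g.symm.trans ((zeroAtInftyNatProdEquiv C(K, ℝ)).symm.trans
    (g.prodCongr (.refl ℝ _)))⟩⟩
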